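/- Let $x=x[1]\cdots x[n]$ be a string of length $n$ over an alphabet $\Sigma$. For a string $u$, call $x$ cyclic-coverable by $u$ if for every position $i$ of $x$ there are $1\le\beta\le i\le\gamma\le n$ such that the factor $x[\beta\mathinner{.\,.}\gamma]$ is a rotation of $u$ (that is, $u=vw$ and $x[\beta\mathinner{.\,.}\gamma]=wv$ for some strings $v,w$). Call $x$ $k'$-cyclic coverable if it is cyclic-coverable by some string $u$ of length $k'$. Theorem. There is an algorithm that, given a string $x$ of length $n$ and an integer $k'$ with $1\le k'\le n$, tests whether $x$ is $k'$-cyclic coverable in $\mathcal{O}(n)$ time and $\mathcal{O}(n)$ space. Here time and space are those of the word RAM: letters and numbers are stored in words of $w$ bits, where $\Sigma=\{0,\dots,\sigma-1\}$ with $\sigma\le 2^w$ and $w\ge\log_2 n+c$ for a constant $c$; copying a word, addition and subtraction modulo $2^w$, comparison and indirect memory access take one unit of time each; space is the number of words of memory. The algorithm and the constants are independent of $n$, $k'$, $\sigma$, $w$ and $x$. -/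

import Mathlib

/-! ### Cyclic covers of strings -/

/-- The factor `x[i .. j]` of a string, both ends included, positions counted from `0`. -/
def factor {α : Type*} (x : List α) (i j : ℕ) : List α :=
  (x.drop i).take (j + 1 - i)

/-- `x` is cyclic-coverable by `u`: every position `i` of `x` lies in a factor `x[b .. e]`
of `x` that is a rotation of `u`. -/
def CyclicCoverableBy {α : Type*} (x u : List α) : Prop :=
  ∀ i < x.length, ∃ b e : ℕ, b ≤ i ∧ i ≤ e ∧ e < x.length ∧ List.IsRotated (factor x b e) u

/-- `x` is `k`-cyclic coverable: it is cyclic-coverable by some string of length `k`. -/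
def CyclicCoverable {α : Type*} (k : ℕ) (x : List α) : Prop :=
  ∃ u : List α, u.length = k ∧ CyclicCoverableBy x u

/-! ### The word RAM

The machine has words of `w` bits, that is, numbers below `2 ^ w` with arithmetic modulo `2 ^ w`;
registers, of which a program can mention only finitely many; and a memory of words, which is
addressed by the content of a register. Every executed instruction costs one unit of time. -/

namespace WordRAM

/-- Instructions. The arguments `d`, `a`, `b` are indices of registers, `c` is a constant, and
`l` is a position in the program. -/
inductive Instr : Type
  /-- `d := c` -/
  | const (d c : ℕ)
  /-- `d := a` -/
  | move (d a : ℕ)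
  /-- `d := a + b` modulo `2 ^ w` -/
  | add (d a b : ℕ)
  /-- `d := a - b` modulo `2 ^ w` -/
  | sub (d a b : ℕ)
  /-- `d := memory[a]` -/
  | load (d a : ℕ)
  /-- `memory[a] := b` -/
  | store (a b : ℕ)
  /-- go to `l` -/
  | jump (l : ℕ)
  /-- go to `l` if `a = b` -/
  | jumpEq (a b l : ℕ)
  /-- go to `l` if `a < b` -/
  | jumpLt (a b l : ℕ)
  /-- stop -/
  | halt

/-- A program is a finite list of instructions. It does not depend on the input or on `w`. -/
abbrev Program : Type := List Instr

/-- A configuration: program counter, registers, and memory. -/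
structure State : Type where
  pc : ℕ
  reg : ℕ → ℕ
  mem : ℕ → ℕ

/-- Write `v` into register `d` and proceed to the next instruction. -/
def State.setReg (s : State) (d v : ℕ) : State :=
  { pc := s.pc + 1, reg := Function.update s.reg d v, mem := s.mem }

/-- Write `v` into the memory cell with address `p` and proceed to the next instruction. -/
def State.setMem (s : State) (p v : ℕ) : State :=
  { pc := s.pc + 1, reg := s.reg, mem := Function.update s.mem p v }

/-- Continue at position `l` of the program. -/
def State.goTo (s : State) (l : ℕ) : State :=
  { pc := l, reg := s.reg, mem := s.mem }

/-- The effect of one instruction with words of `w` bits; `none` means that the machine stops. -/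
def Instr.exec (w : ℕ) (s : State) : Instr → Option State
  | .const d c => some (s.setReg d (c % 2 ^ w))
  | .move d a => some (s.setReg d (s.reg a))
  | .add d a b => some (s.setReg d ((s.reg a + s.reg b) % 2 ^ w))
  | .sub d a b => some (s.setReg d ((s.reg a + 2 ^ w - s.reg b) % 2 ^ w))
  | .load d a => some (s.setReg d (s.mem (s.reg a)))
  | .store a b => some (s.setMem (s.reg a) (s.reg b))
  | .jump l => some (s.goTo l)
  | .jumpEq a b l => some (s.goTo (if s.reg a = s.reg b then l else s.pc + 1))
  | .jumpLt a b l => some (s.goTo (if s.reg a < s.reg b then l else s.pc + 1))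
  | .halt => none

/-- The address of the memory cell that an instruction reads or writes, if there is one. -/
def Instr.address (s : State) : Instr → Option ℕ
  | .load _ a => some (s.reg a)
  | .store a _ => some (s.reg a)
  | _ => none

/-- One step of the machine; `none` if it has stopped (at `halt`, or outside of the program). -/
def step (P : Program) (w : ℕ) (s : State) : Option State :=
  (P[s.pc]?).bind (Instr.exec w s)

/-- The address of the memory cell that the next step reads or writes, if there is one. -/
def accessed (P : Program) (s : State) : Option ℕ :=
  (P[s.pc]?).bind (Instr.address s)

/-- `Steps P w S s t s'`: the machine gets from `s` to `s'` in exactly `t` steps, which read and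
write no memory cells other than those with addresses `0, …, S - 1`. -/
inductive Steps (P : Program) (w S : ℕ) : State → ℕ → State → Prop
  | refl (s : State) : Steps P w S s 0 s
  | head {s s₁ s₂ : State} {t : ℕ} (hstep : step P w s = some s₁)
      (hspace : ∀ p, accessed P s = some p → p < S) (htail : Steps P w S s₁ t s₂) :
      Steps P w S s (t + 1) s₂

/-- From `s` the machine stops after at most `T` steps, which use only the first `S` memory cells,
and then register `0` contains `out`. -/
def HaltsWithin (P : Program) (w : ℕ) (s : State) (T S out : ℕ) : Prop :=
  ∃ (t : ℕ) (s' : State),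
    t ≤ T ∧ Steps P w S s t s' ∧ step P w s' = none ∧ s'.reg 0 = out

/-- The initial configuration for a string `x` over the alphabet `{0, …, σ - 1}` and a number `k`:
register `0` contains the length of `x`, register `1` contains `k`, the memory cells
`0, …, |x| - 1` contain the letters of `x`, and everything else is `0`. -/
def initial {σ : ℕ} (x : List (Fin σ)) (k : ℕ) : State where
  pc := 0
  reg := fun r => if r = 0 then x.length else if r = 1 then k else 0
  mem := fun p => (x.map Fin.val).getD p 0

end WordRAM

/-! Position 0 can only be covered by a factor that starts there, and that factor is the prefix `v`
of length `k`; so `v` may replace the unknown `u` (`cyclicCoverable_iff_take`). A window of length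
`k` is a rotation of `v` iff it splits at some `j` into a suffix of `v` ending before `j` and a
prefix of `v` starting at `j`. Let `s j` and `p j` be the longest such matches, capped at `k`. If `k
≤ p j + s j`, every window of length `k` inside `[j - s j, j + p j)` is a rotation of `v`, and these
windows fill the interval. Hence coverability means that these at most `n` intervals cover all
positions (`cyclicCoverable_iff`).

Two runs of the Z-algorithm give all `p j` and `s j`: one on the string, one on the reversal of `v`
followed by the reversal of the string (`wp_computeTables`). Storing for each left end the greatest
right end (`wp_markIntervals`) and sweeping with a running maximum (`wp_checkCover`) decides the
covering in linear time.

The machine-level proof uses structured programs and a predicate `WP` whose postconditions also see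
the number of unspent steps. A loop invariant thus carries a potential function, which yields the
amortised bound for the Z-algorithm (`wp_zAlgorithm`). -/

namespace WordRAM

/-! ### Structured programs and a program logic that counts steps. -/

theorem Steps.trans {P : Program} {w S : ℕ} {s₁ s₂ s₃ : State} {t₁ t₂ : ℕ}
    (h₁ : Steps P w S s₁ t₁ s₂) (h₂ : Steps P w S s₂ t₂ s₃) : Steps P w S s₁ (t₁ + t₂) s₃ := by
  induction h₁ with
  | refl s => simpa using h₂
  | head hs hp _ ih =>
    rw [Nat.add_right_comm]
    exact Steps.head hs hp (ih h₂)

theorem Steps.single {P : Program} {w S : ℕ} {s s' : State} {i : Instr} (hi : P[s.pc]? = some i)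
    (hs : i.exec w s = some s') (hp : ∀ p, i.address s = some p → p < S) :
    Steps P w S s 1 s' :=
  .head (by simp [step, hi, hs]) (by simpa [accessed, hi] using hp) (.refl s')

/-- Structured programs. A block is a list of instructions that do not jump. -/
inductive Cmd : Type
  | block (l : List Instr)
  | seq (c₁ c₂ : Cmd)
  | ifLt (a b : ℕ) (c₁ c₂ : Cmd)
  | ifEq (a b : ℕ) (c₁ c₂ : Cmd)
  | whileLt (a b : ℕ) (c : Cmd)

namespace Cmd

/-- The number of instructions of the compiled program. -/
def size : Cmd → ℕ
  | block l => l.length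
  | seq c₁ c₂ => c₁.size + c₂.size
  | ifLt _ _ c₁ c₂ => c₁.size + c₂.size + 2
  | ifEq _ _ c₁ c₂ => c₁.size + c₂.size + 2
  | whileLt _ _ c => c.size + 3

/-- The instructions of a structured program that is placed at position `o`. -/
def compile : Cmd → ℕ → Program
  | block l, _ => l
  | seq c₁ c₂, o => c₁.compile o ++ c₂.compile (o + c₁.size)
  | ifLt a b c₁ c₂, o =>
      .jumpLt a b (o + 2 + c₂.size) :: (c₂.compile (o + 1) ++
        .jump (o + 2 + c₂.size + c₁.size) :: c₁.compile (o + 2 + c₂.size))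
  | ifEq a b c₁ c₂, o =>
      .jumpEq a b (o + 2 + c₂.size) :: (c₂.compile (o + 1) ++
        .jump (o + 2 + c₂.size + c₁.size) :: c₁.compile (o + 2 + c₂.size))
  | whileLt a b c, o =>
      .jumpLt a b (o + 2) :: .jump (o + c.size + 3) :: (c.compile (o + 2) ++ [.jump o])

theorem length_compile (c : Cmd) (o : ℕ) : (c.compile o).length = c.size := by
  induction c generalizing o with
  | block l => rfl
  | seq c₁ c₂ h₁ h₂ => simp [compile, size, h₁, h₂]
  | ifLt a b c₁ c₂ h₁ h₂ => simp [compile, size, h₁, h₂]; omega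
  | ifEq a b c₁ c₂ h₁ h₂ => simp [compile, size, h₁, h₂]; omega
  | whileLt a b c h => simp [compile, size, h]

end Cmd

/-- The program `P` contains the instructions `l` from position `o` on. -/
def CodeAt (P : Program) (o : ℕ) (l : Program) : Prop :=
  ∀ i < l.length, P[o + i]? = l[i]?

theorem codeAt_nil (P : Program) (o : ℕ) : CodeAt P o [] := by
  intro i hi; simp at hi

theorem codeAt_cons {P : Program} {o : ℕ} {i : Instr} {l : Program} :
    CodeAt P o (i :: l) ↔ P[o]? = some i ∧ CodeAt P (o + 1) l := by
  constructor
  · intro h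
    refine ⟨by simpa using h 0 (by simp), fun j hj => ?_⟩
    have := h (j + 1) (by simpa using hj)
    rwa [List.getElem?_cons_succ, ← Nat.add_assoc, Nat.add_right_comm] at this
  · rintro ⟨h₀, h⟩ (_ | j) hj
    · simpa using h₀
    · rw [List.getElem?_cons_succ, ← h j (by simpa using hj)]
      congr 1; omega

theorem codeAt_append {P : Program} {o : ℕ} {l₁ l₂ : Program} :
    CodeAt P o (l₁ ++ l₂) ↔ CodeAt P o l₁ ∧ CodeAt P (o + l₁.length) l₂ := by
  induction l₁ generalizing o with
  | nil => simp [codeAt_nil]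
  | cons i l ih =>
    rw [List.cons_append, codeAt_cons, codeAt_cons, ih, and_assoc, List.length_cons,
      Nat.add_assoc o 1, Nat.add_comm 1]

/-- A sufficient condition for a block to run without overflow and without leaving the first `S`
memory cells, and to end with registers and memory that satisfy `Q`. -/
def blockPre (w S : ℕ) (Q : (ℕ → ℕ) → (ℕ → ℕ) → Prop) :
    List Instr → (ℕ → ℕ) → (ℕ → ℕ) → Prop
  | [], r, m => Q r m
  | .const d c :: l, r, m => c < 2 ^ w ∧ blockPre w S Q l (Function.update r d c) m
  | .move d a :: l, r, m => blockPre w S Q l (Function.update r d (r a)) m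
  | .add d a b :: l, r, m =>
      r a + r b < 2 ^ w ∧ blockPre w S Q l (Function.update r d (r a + r b)) m
  | .sub d a b :: l, r, m =>
      (r b ≤ r a ∧ r a < 2 ^ w) ∧ blockPre w S Q l (Function.update r d (r a - r b)) m
  | .load d a :: l, r, m => r a < S ∧ blockPre w S Q l (Function.update r d (m (r a))) m
  | .store a b :: l, r, m => r a < S ∧ blockPre w S Q l r (Function.update m (r a) (r b))
  | _ :: _, _, _ => False

theorem blockPre.steps {P : Program} {w S : ℕ} {Q : (ℕ → ℕ) → (ℕ → ℕ) → Prop} {l : List Instr}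
    {r m : ℕ → ℕ} {o : ℕ} (h : blockPre w S Q l r m) (hP : CodeAt P o l) :
    ∃ r' m', Steps P w S ⟨o, r, m⟩ l.length ⟨o + l.length, r', m'⟩ ∧ Q r' m' := by
  induction l generalizing r m o with
  | nil => exact ⟨r, m, .refl _, h⟩
  | cons i l ih =>
    rw [codeAt_cons] at hP
    obtain ⟨hi, hl⟩ := hP
    have main : ∀ r₁ m₁, blockPre w S Q l r₁ m₁ → i.exec w ⟨o, r, m⟩ = some ⟨o + 1, r₁, m₁⟩ →
        (∀ p, i.address ⟨o, r, m⟩ = some p → p < S) →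
        ∃ r' m', Steps P w S ⟨o, r, m⟩ (i :: l).length ⟨o + (i :: l).length, r', m'⟩ ∧
          Q r' m' := by
      intro r₁ m₁ h₁ he ha
      obtain ⟨r', m', hs, hQ⟩ := ih h₁ hl
      refine ⟨r', m', ?_, hQ⟩
      have := (Steps.single (s := ⟨o, r, m⟩) hi he ha).trans hs
      rwa [Nat.add_assoc o, Nat.add_comm 1] at this
    cases i with
    | const d c =>
      exact main _ _ h.2 (by simp [Instr.exec, State.setReg, Nat.mod_eq_of_lt h.1])
        (by simp [Instr.address])
    | move d a =>
      exact main _ _ h (by simp [Instr.exec, State.setReg]) (by simp [Instr.address])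
    | add d a b =>
      exact main _ _ h.2 (by simp [Instr.exec, State.setReg, Nat.mod_eq_of_lt h.1])
        (by simp [Instr.address])
    | sub d a b =>
      refine main _ _ h.2 ?_ (by simp [Instr.address])
      have : (r a + 2 ^ w - r b) % 2 ^ w = r a - r b := by
        obtain ⟨h₁, h₂⟩ := h.1
        rw [Nat.sub_add_comm h₁, Nat.add_mod_right, Nat.mod_eq_of_lt (by omega)]
      simp [Instr.exec, State.setReg, this]
    | load d a =>
      exact main _ _ h.2 (by simp [Instr.exec, State.setReg])
        (by simpa [Instr.address] using h.1)
    | store a b =>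
      exact main _ _ h.2 (by simp [Instr.exec, State.setMem])
        (by simpa [Instr.address] using h.1)
    | jump _ => exact h.elim
    | jumpEq _ _ _ => exact h.elim
    | jumpLt _ _ _ => exact h.elim
    | halt => exact h.elim

/-- Started with registers `r` and memory `m`, the program `c` terminates in at most `T` steps,
uses only the first `S` memory cells, and `Q` holds for the number of steps that are left of `T`
and for the resulting registers and memory. -/
def WP (w S : ℕ) (c : Cmd) (Q : ℕ → (ℕ → ℕ) → (ℕ → ℕ) → Prop) (T : ℕ) (r m : ℕ → ℕ) : Prop :=
  ∀ (P : Program) (o : ℕ), CodeAt P o (c.compile o) →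
    ∃ t r' m', t ≤ T ∧ Steps P w S ⟨o, r, m⟩ t ⟨o + c.size, r', m'⟩ ∧ Q (T - t) r' m'

section WP

variable {w S : ℕ} {Q : ℕ → (ℕ → ℕ) → (ℕ → ℕ) → Prop} {T : ℕ} {r m : ℕ → ℕ}

theorem WP.block {l : List Instr} (hT : l.length ≤ T)
    (h : blockPre w S (Q (T - l.length)) l r m) : WP w S (.block l) Q T r m := by
  intro P o hP
  obtain ⟨r', m', hs, hQ⟩ := h.steps hP
  exact ⟨_, r', m', hT, hs, hQ⟩

theorem WP.seq {c₁ c₂ : Cmd} (h : WP w S c₁ (WP w S c₂ Q) T r m) :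
    WP w S (.seq c₁ c₂) Q T r m := by
  intro P o hP
  rw [Cmd.compile, codeAt_append, Cmd.length_compile] at hP
  obtain ⟨t₁, r₁, m₁, ht₁, hs₁, h₁⟩ := h P o hP.1
  obtain ⟨t₂, r₂, m₂, ht₂, hs₂, h₂⟩ := h₁ P _ hP.2
  refine ⟨t₁ + t₂, r₂, m₂, by omega, ?_, by rwa [Nat.sub_add_eq]⟩
  rw [Cmd.size, ← Nat.add_assoc]
  exact hs₁.trans hs₂

/-- The code of `c₂` comes first and ends with a jump over `c₁`. That path costs two jumps, the path
through `c₁` only one; both are charged two, and `Q (T + 1)` refunds the difference. -/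
theorem WP.ifLt {a b : ℕ} {c₁ c₂ : Cmd} (hT : 2 ≤ T)
    (h₁ : r a < r b → WP w S c₁ (fun T => Q (T + 1)) (T - 2) r m)
    (h₂ : ¬ r a < r b → WP w S c₂ Q (T - 2) r m) : WP w S (.ifLt a b c₁ c₂) Q T r m := by
  intro P o hP
  rw [Cmd.compile, codeAt_cons, codeAt_append, codeAt_cons, Cmd.length_compile] at hP
  obtain ⟨hj, hc₂, hj', hc₁⟩ := hP
  by_cases hab : r a < r b
  · rw [show o + 1 + c₂.size + 1 = o + 2 + c₂.size by omega] at hc₁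
    obtain ⟨t, r', m', ht, hs, hq⟩ := h₁ hab P _ hc₁
    refine ⟨1 + t, r', m', by omega, (Steps.single (s := ⟨o, r, m⟩) hj
      (s' := ⟨o + 2 + c₂.size, r, m⟩) (by simp [Instr.exec, State.goTo, hab])
      (by simp [Instr.address])).trans ?_, ?_⟩
    · rwa [Cmd.size, show o + (c₁.size + c₂.size + 2) = o + 2 + c₂.size + c₁.size by omega]
    · rwa [show T - (1 + t) = T - 2 - t + 1 by omega]
  · obtain ⟨t, r', m', ht, hs, hq⟩ := h₂ hab P _ hc₂
    refine ⟨1 + t + 1, r', m', by omega, ((Steps.single (s := ⟨o, r, m⟩) hj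
      (s' := ⟨o + 1, r, m⟩) (by simp [Instr.exec, State.goTo, hab])
      (by simp [Instr.address])).trans hs).trans (Steps.single hj' ?_ (by simp [Instr.address])),
      ?_⟩
    · simp [Instr.exec, State.goTo, Cmd.size]; omega
    · rwa [show T - (1 + t + 1) = T - 2 - t by omega]

theorem WP.ifEq {a b : ℕ} {c₁ c₂ : Cmd} (hT : 2 ≤ T)
    (h₁ : r a = r b → WP w S c₁ (fun T => Q (T + 1)) (T - 2) r m)
    (h₂ : ¬ r a = r b → WP w S c₂ Q (T - 2) r m) : WP w S (.ifEq a b c₁ c₂) Q T r m := by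
  intro P o hP
  rw [Cmd.compile, codeAt_cons, codeAt_append, codeAt_cons, Cmd.length_compile] at hP
  obtain ⟨hj, hc₂, hj', hc₁⟩ := hP
  by_cases hab : r a = r b
  · rw [show o + 1 + c₂.size + 1 = o + 2 + c₂.size by omega] at hc₁
    obtain ⟨t, r', m', ht, hs, hq⟩ := h₁ hab P _ hc₁
    refine ⟨1 + t, r', m', by omega, (Steps.single (s := ⟨o, r, m⟩) hj
      (s' := ⟨o + 2 + c₂.size, r, m⟩) (by simp [Instr.exec, State.goTo, hab])
      (by simp [Instr.address])).trans ?_, ?_⟩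
    · rwa [Cmd.size, show o + (c₁.size + c₂.size + 2) = o + 2 + c₂.size + c₁.size by omega]
    · rwa [show T - (1 + t) = T - 2 - t + 1 by omega]
  · obtain ⟨t, r', m', ht, hs, hq⟩ := h₂ hab P _ hc₂
    refine ⟨1 + t + 1, r', m', by omega, ((Steps.single (s := ⟨o, r, m⟩) hj
      (s' := ⟨o + 1, r, m⟩) (by simp [Instr.exec, State.goTo, hab])
      (by simp [Instr.address])).trans hs).trans (Steps.single hj' ?_ (by simp [Instr.address])),
      ?_⟩
    · simp [Instr.exec, State.goTo, Cmd.size]; omega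
    · rwa [show T - (1 + t + 1) = T - 2 - t by omega]

/-- The rule for loops. The invariant bounds the number of steps that are left from below, so that
it serves as a potential function for the running time, too. -/
theorem WP.whileLt {a b : ℕ} {c : Cmd} (I : ℕ → (ℕ → ℕ) → (ℕ → ℕ) → Prop) (h₀ : I T r m)
    (hbody : ∀ T r m, I T r m → r a < r b →
      2 ≤ T ∧ WP w S c (fun T => I T) (T - 2) r m)
    (hexit : ∀ T r m, I T r m → ¬ r a < r b → 2 ≤ T ∧ Q (T - 2) r m) :
    WP w S (.whileLt a b c) Q T r m := by
  intro P o hP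
  have hP' := hP
  rw [Cmd.compile, codeAt_cons, codeAt_cons, codeAt_append, codeAt_cons,
    Cmd.length_compile] at hP'
  obtain ⟨hj, hj', hc, hback, -⟩ := hP'
  -- Every round spends at least its two jumps, so the remaining budget decreases and termination
  -- needs no separate measure.
  induction T using Nat.strong_induction_on generalizing r m with
  | _ T ih =>
    by_cases hab : r a < r b
    · obtain ⟨hT, hb⟩ := hbody _ _ _ h₀ hab
      obtain ⟨t, r₁, m₁, ht, hs, hI⟩ := hb P _ hc
      obtain ⟨t', r', m', ht', hs', hq⟩ := ih (T - 2 - t) (by omega) hI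
      refine ⟨1 + t + 1 + t', r', m', by omega, (((Steps.single (s := ⟨o, r, m⟩) hj
        (s' := ⟨o + 2, r, m⟩) (by simp [Instr.exec, State.goTo, hab])
        (by simp [Instr.address])).trans hs).trans (Steps.single hback (s' := ⟨o, r₁, m₁⟩)
        (by simp [Instr.exec, State.goTo]) (by simp [Instr.address]))).trans hs', ?_⟩
      rwa [show T - (1 + t + 1 + t') = T - 2 - t - t' by omega]
    · obtain ⟨hT, hq⟩ := hexit _ _ _ h₀ hab
      refine ⟨1 + 1, r, m, hT, (Steps.single (s := ⟨o, r, m⟩) hj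
        (s' := ⟨o + 1, r, m⟩) (by simp [Instr.exec, State.goTo, hab])
        (by simp [Instr.address])).trans (Steps.single hj' ?_ (by simp [Instr.address])), hq⟩
      simp [Instr.exec, State.goTo, Cmd.size, Nat.add_assoc]

theorem WP.haltsWithin {c : Cmd} {out : ℕ} (h : WP w S c (fun _ r _ => r 0 = out) T r m) :
    HaltsWithin (c.compile 0) w ⟨0, r, m⟩ T S out := by
  obtain ⟨t, r', m', ht, hs, hq⟩ := h (c.compile 0) 0 (by intro i _; simp)
  refine ⟨t, _, ht, hs, ?_, hq⟩
  -- The program counter is just past the last instruction, where the machine stops.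
  simp [step, Cmd.length_compile]

end WP

end WordRAM

/-! ### Cyclic covers in terms of common prefixes and suffixes -/

theorem cyclicCoverableBy_congr {α : Type*} {x u v : List α} (h : u ~r v)
    (hu : CyclicCoverableBy x u) : CyclicCoverableBy x v := fun i hi =>
  let ⟨b, e, hb, hi, he, hr⟩ := hu i hi
  ⟨b, e, hb, hi, he, hr.trans h⟩

/-- The factor that covers position 0 starts at 0 and has length `k`. So `u` is a rotation of the
prefix, and being a rotation is transitive. -/
theorem cyclicCoverable_iff_take {α : Type*} {x : List α} {k : ℕ} (hk : 1 ≤ k)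
    (hkn : k ≤ x.length) : CyclicCoverable k x ↔ CyclicCoverableBy x (x.take k) := by
  refine ⟨fun ⟨u, huk, hu⟩ => ?_, fun h => ⟨_, by simpa using hkn, h⟩⟩
  obtain ⟨b, e, hb, -, he, hr⟩ := hu 0 (by omega)
  obtain rfl : b = 0 := by omega
  have hlen := hr.perm.length_eq
  have : e + 1 = k := by
    simp [factor] at hlen; omega
  refine cyclicCoverableBy_congr (List.IsRotated.symm ?_) hu
  simpa [factor, this] using hr

/-- Rotations of a prefix of the string, letter by letter. -/
theorem factor_isRotated_take_iff {α : Type*} {x : List α} {k b e : ℕ} (hk : 1 ≤ k)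
    (hkn : k ≤ x.length) (he : e < x.length) (d : α) :
    factor x b e ~r x.take k ↔
      e + 1 = b + k ∧ ∃ a ≤ k, ∀ t < k, x.getD t d = x.getD (b + (t + a) % k) d := by
  constructor
  · intro h
    have hlen := h.perm.length_eq
    have hbe : e + 1 = b + k := by simp [factor] at hlen; omega
    refine ⟨hbe, ?_⟩
    obtain ⟨a, ha, hr⟩ := List.isRotated_iff_mod.1 h
    have hfl : (factor x b e).length = k := by simp [hlen, hkn]
    refine ⟨a, by omega, fun t ht => ?_⟩
    have hmod : (t + a) % k < k := Nat.mod_lt _ hk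
    have : ((factor x b e).rotate a)[t]? = (x.take k)[t]? := by rw [hr]
    rw [List.getElem?_rotate (by omega), hfl] at this
    simp only [factor, List.getElem?_take, List.getElem?_drop] at this
    rw [if_pos (by omega), if_pos ht] at this
    simp [List.getD, this]
  · rintro ⟨hbe, a, ha, h⟩
    have hfl : (factor x b e).length = k := by simp [factor]; omega
    refine ⟨a, List.ext_getElem? fun t => ?_⟩
    by_cases ht : t < k
    · have hmod : (t + a) % k < k := Nat.mod_lt _ hk
      rw [List.getElem?_rotate (by omega), hfl]
      simp only [factor, List.getElem?_take, List.getElem?_drop]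
      rw [if_pos (by omega), if_pos ht]
      have := h t ht
      rw [List.getD_eq_getElem _ _ (by omega), List.getD_eq_getElem _ _ (by omega)] at this
      rw [List.getElem?_eq_getElem (by omega), List.getElem?_eq_getElem (by omega), this]
    · rw [List.getElem?_eq_none (by simp [hfl]; omega), List.getElem?_eq_none (by simp; omega)]

/-! ### Longest common prefixes of a string with its suffixes. -/

/-- `z` is the length of the longest common prefix of `f[0 .. m - 1]` and `f[i .. m - 1]`. -/
def IsPrefixLength (f : ℕ → ℕ) (m i z : ℕ) : Prop :=
  ∀ q, q ≤ z ↔ i + q ≤ m ∧ ∀ t < q, f t = f (i + t)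

/-- This is the certificate that letter comparisons produce: a match followed by a mismatch or by
the end of the string. -/
theorem isPrefixLength_of_mismatch {f : ℕ → ℕ} {m i z : ℕ} (hz : i + z ≤ m)
    (hf : ∀ t < z, f t = f (i + t)) (hne : i + z < m → f z ≠ f (i + z)) :
    IsPrefixLength f m i z := by
  refine fun q => ⟨fun hq => ⟨by omega, fun t ht => hf t (by omega)⟩, fun ⟨hq, h⟩ => ?_⟩
  by_contra! hlt
  exact hne (by omega) (h z hlt)

theorem IsPrefixLength.add_le {f : ℕ → ℕ} {m i z : ℕ} (h : IsPrefixLength f m i z) :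
    i + z ≤ m :=
  ((h z).1 le_rfl).1

theorem IsPrefixLength.eq {f : ℕ → ℕ} {m i z t : ℕ} (h : IsPrefixLength f m i z) (ht : t < z) :
    f t = f (i + t) :=
  ((h z).1 le_rfl).2 t ht

theorem IsPrefixLength.ne {f : ℕ → ℕ} {m i z : ℕ} (h : IsPrefixLength f m i z)
    (hz : i + z < m) : f z ≠ f (i + z) := fun he => by
  have := (h (z + 1)).2 ⟨by omega, fun t ht => by
    rcases Nat.lt_succ_iff_lt_or_eq.1 ht with ht | rfl
    · exact h.eq ht
    · exact he⟩
  omega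

theorem IsPrefixLength.congr {f g : ℕ → ℕ} {m i z : ℕ} (h : IsPrefixLength f m i z)
    (hfg : ∀ t < m, f t = g t) : IsPrefixLength g m i z := by
  refine fun q => (h q).trans (and_congr_right fun hq => forall₂_congr fun t ht => ?_)
  rw [hfg t (by omega), hfg (i + t) (by omega)]

/-- If `f[l .. r - 1]` is a prefix of `f`, then a prefix length at a position `i` inside of it is
known from the one at `i - l`, provided that it does not reach `r`. -/
theorem IsPrefixLength.shift {f : ℕ → ℕ} {m l r i z : ℕ} (hl : l ≤ i) (hr : r ≤ m)
    (hbox : ∀ t, l ≤ t → t < r → f t = f (t - l)) (h : IsPrefixLength f m (i - l) z)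
    (hz : i + z < r) : IsPrefixLength f m i z := by
  have hs : ∀ t, i + t < r → f (i + t) = f (i - l + t) := fun t ht => by
    rw [hbox _ (by omega) ht]; congr 1; omega
  refine isPrefixLength_of_mismatch (by omega) (fun t ht => ?_) fun _ => ?_
  · rw [hs t (by omega), h.eq ht]
  -- Since `i + z < r`, the mismatching letter also lies in the copied region, so the mismatch
  -- carries over.
  · rw [hs z hz]
    exact h.ne (by omega)

/-! ### The covering criterion. -/

/-- Let `p j` and `s j` be the greatest lengths up to `k` such that the letters from `j` on agree
with the first letters of the string, and the letters before `j` with those before `k`,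
respectively. Then the string is `k`-cyclic coverable iff the intervals from `j - s j` to
`j + p j - 1` with `k ≤ p j + s j` cover all positions. -/
theorem cyclicCoverable_iff {α : Type*} {x : List α} {k : ℕ} (hk : 1 ≤ k) (hkn : k ≤ x.length)
    {g : ℕ → ℕ} (hg : ∀ i < x.length, ∀ j < x.length, ∀ d, x.getD i d = x.getD j d ↔ g i = g j)
    {p s : ℕ → ℕ}
    (hp : ∀ j < x.length, ∀ q, q ≤ p j ↔ q ≤ k ∧ j + q ≤ x.length ∧ ∀ t < q, g t = g (j + t))
    (hs : ∀ j < x.length, ∀ q, q ≤ s j ↔ q ≤ k ∧ q ≤ j ∧ ∀ t < q, g (k - 1 - t) = g (j - 1 - t)) :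
    CyclicCoverable k x ↔ ∀ i < x.length, ∃ j < x.length,
      k ≤ p j + s j ∧ j - s j ≤ i ∧ i < j + p j := by
  -- Any letter serves as the default of `getD`: only positions inside the string are read.
  have d : α := x[0]
  rw [cyclicCoverable_iff_take hk hkn]
  refine forall₂_congr fun i hi => ⟨?_, ?_⟩
  · rintro ⟨b, e, hb, hie, he, hr⟩
    obtain ⟨hbe, a, ha, h⟩ := (factor_isRotated_take_iff hk hkn he d).1 hr
    -- Shifts `0` and `k` give the same rotation. Excluding `k` makes the split point `b + a` a
    -- position of the string even if the window ends the string.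
    wlog hak : a < k generalizing a
    · obtain rfl : a = k := by omega
      exact this 0 (by omega) (by simpa using h) hk
    have hp' : k - a ≤ p (b + a) := by
      refine (hp _ (by omega) _).2 ⟨by omega, by omega, fun t ht => ?_⟩
      have := h t (by omega)
      rw [Nat.mod_eq_of_lt (by omega), hg _ (by omega) _ (by omega)] at this
      rw [this]; congr 1; omega
    have hs' : a ≤ s (b + a) := by
      refine (hs _ (by omega) _).2 ⟨by omega, by omega, fun t ht => ?_⟩
      have := h (k - 1 - t) (by omega)
      rw [show k - 1 - t + a = a - 1 - t + k by omega, Nat.add_mod_right,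
        Nat.mod_eq_of_lt (by omega), hg _ (by omega) _ (by omega)] at this
      rw [this]; congr 1; omega
    exact ⟨b + a, by omega, by omega, by omega, by omega⟩
  · rintro ⟨j, hj, hps, hl, hr⟩
    obtain ⟨hpk, hpn, hpe⟩ := (hp j hj _).1 le_rfl
    obtain ⟨hsk, hsj, hse⟩ := (hs j hj _).1 le_rfl
    -- The window is the leftmost one in the interval if it contains `i`, and otherwise the one that
    -- ends at `i`. The caps at `k` force `b ≤ j ≤ b + k`.
    obtain ⟨b, hb₁, hb₂, hb₃, hb₄⟩ : ∃ b, j - s j ≤ b ∧ b ≤ i ∧ i < b + k ∧ b + k ≤ j + p j := by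
      by_cases h : i < j - s j + k
      · exact ⟨j - s j, le_rfl, hl, h, by omega⟩
      · exact ⟨i + 1 - k, by omega, by omega, by omega, by omega⟩
    refine ⟨b, b + k - 1, hb₂, by omega, by omega,
      (factor_isRotated_take_iff hk hkn (by omega) d).2
        ⟨by omega, j - b, by omega, fun t ht => ?_⟩⟩
    have hmod : (t + (j - b)) % k < k := Nat.mod_lt _ hk
    rw [hg _ (by omega) _ (by omega)]
    by_cases h : t + (j - b) < k
    · rw [Nat.mod_eq_of_lt h, hpe t (by omega)]; congr 1; omega
    · rw [show t + (j - b) = t + (j - b) - k + k by omega, Nat.add_mod_right,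
        Nat.mod_eq_of_lt (by omega)]
      have := hse (k - 1 - t) (by omega)
      rw [show k - 1 - (k - 1 - t) = t by omega] at this
      rw [this]; congr 1; omega

namespace WordRAM

/-! ### The program

Registers `0` to `3` contain the length `n` of the string, `k`, `1` and `0` throughout. -/

/-- The contents of the registers that the subroutines leave alone. -/
def Globals (n k : ℕ) (r : ℕ → ℕ) : Prop :=
  r 0 = n ∧ r 1 = k ∧ r 2 = 1 ∧ r 3 = 0

/-- Copies the first cells of the memory, as many as register `5` says, in reverse order to the
address in register `6`, and advances that address. -/
def reverseCopy : Cmd :=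
  .whileLt 3 5 (.block [.sub 5 5 2, .load 8 5, .store 6 8, .add 6 6 2])

variable {w S n k : ℕ} {Q : ℕ → (ℕ → ℕ) → (ℕ → ℕ) → Prop} {T : ℕ} {r m : ℕ → ℕ}

/-- The invariant of `reverseCopy` with length `L` and destination `D` after `p` rounds. -/
structure CopyInv (n k L D : ℕ) (m₀ : ℕ → ℕ) (T p T' : ℕ) (r m : ℕ → ℕ) : Prop where
  globals : Globals n k r
  le : p ≤ L
  reg_len : r 5 = L - p
  reg_dest : r 6 = D + p
  time : T ≤ T' + 6 * p
  frame : ∀ q, q < D ∨ D + p ≤ q → m q = m₀ q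
  copied : ∀ q < p, m (D + q) = m₀ (L - 1 - q)

theorem wp_reverseCopy {L D : ℕ} (hS : S < 2 ^ w) (hr : Globals n k r) (h5 : r 5 = L)
    (h6 : r 6 = D) (hLD : L ≤ D) (hDS : D + L ≤ S) (hT : 6 * L + 2 ≤ T)
    (hQ : ∀ T' r' m', T ≤ T' + (6 * L + 2) → Globals n k r' → r' 6 = D + L →
      (∀ p, p < D ∨ D + L ≤ p → m' p = m p) → (∀ p < L, m' (D + p) = m (L - 1 - p)) →
      Q T' r' m') : WP w S reverseCopy Q T r m := by
  -- A round costs four instructions and the two jumps of the loop; leaving the loop costs two more.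
  refine WP.whileLt (fun T' r' m' => ∃ p, CopyInv n k L D m T p T' r' m')
    ⟨0, hr, by omega, by omega, by omega, by omega, by simp, by simp⟩ ?_ ?_
  · rintro T₁ r₁ m₁ ⟨p, ⟨h0, h1, h2, h3⟩, hp, h5, h6, hT₁, hm, hc⟩ hlt
    rw [h3, h5] at hlt
    refine ⟨by omega, WP.block (by simp; omega) ?_⟩
    simp [blockPre, h2, h5, h6]
    refine ⟨by omega, by omega, by omega, by omega, p + 1, ⟨by simpa, by simpa, by simpa,
      by simpa⟩, by omega, by simp; omega, by simp; omega, by omega, fun q hq => ?_,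
      fun q hq => ?_⟩
    · rw [Function.update_of_ne (by omega), hm q (by omega)]
    · rw [Function.update_apply]
      split_ifs with h
      · rw [hm _ (by omega)]; congr 1; omega
      · exact hc q (by omega)
  · rintro T₁ r₁ m₁ ⟨p, hr₁, hp, h5, h6, hT₁, hm, hc⟩ hlt
    rw [hr₁.2.2.2, h5] at hlt
    obtain rfl : p = L := by omega
    exact ⟨by omega, hQ _ _ _ (by omega) hr₁ h6 hm hc⟩

/-! ### The Z-algorithm. -/

/-- The inner loop of the Z-algorithm: compares letters from registers `10` and `10` minus `8` on,
until a mismatch or the limit in register `11` stops it. -/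
def extendMatch : Cmd :=
  .whileLt 10 11 (.seq
    (.block [.add 12 10 5, .load 12 12, .sub 13 10 8, .add 13 13 5, .load 13 13])
    (.ifEq 12 13 (.block [.add 10 10 2]) (.block [.move 11 10])))

/-- The contents of the registers `5` to `7` during the Z-algorithm. -/
def ZArgs (a M b : ℕ) (r : ℕ → ℕ) : Prop :=
  r 5 = a ∧ r 6 = M ∧ r 7 = b

/-- The invariant of `extendMatch` at position `i`, when the match has been found to extend to
`e'`. The last alternative describes the situation after a mismatch. -/
structure ExtendInv (n k a M b i e : ℕ) (m₀ : ℕ → ℕ) (T e' T' : ℕ) (r m : ℕ → ℕ) : Prop where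
  globals : Globals n k r
  args : ZArgs a M b r
  reg_i : r 8 = i
  reg_l : r 9 = i
  reg_e : r 10 = e'
  le : e ≤ e'
  le_length : e' ≤ M
  mem : m = m₀
  isMatch : ∀ t < e' - i, m₀ (a + t) = m₀ (a + (i + t))
  limit : (r 11 = M ∧ T + 10 * e ≤ T' + 10 * e') ∨
    (r 11 = e' ∧ T + 10 * e ≤ T' + 10 * e' + 12 ∧ 2 ≤ T' ∧ m₀ (a + (e' - i)) ≠ m₀ (a + e'))

theorem wp_extendMatch {a M b i e : ℕ} (hS : S < 2 ^ w) (hr : Globals n k r) (hz : ZArgs a M b r)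
    (h8 : r 8 = i) (h9 : r 9 = i) (h10 : r 10 = e) (h11 : r 11 = M) (hie : i ≤ e) (heM : e ≤ M)
    (haS : a + M ≤ S) (hT : 10 * (M - e) + 14 ≤ T)
    (hmatch : ∀ t < e - i, m (a + t) = m (a + (i + t)))
    (hQ : ∀ T' r' e', T + 10 * e ≤ T' + 10 * e' + 14 → Globals n k r' → ZArgs a M b r' → r' 8 = i →
      r' 9 = i → r' 10 = e' → e ≤ e' → e' ≤ M →
      IsPrefixLength (fun t => m (a + t)) M i (e' - i) → Q T' r' m) :
    WP w S extendMatch Q T r m := by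
  -- A successful comparison is paid for by the advance of `e'`, ten steps per letter. A mismatch
  -- happens at most once, since it lowers the limit to `e'`; it is paid for by the additional 12.
  refine WP.whileLt (fun T' r' m' => ∃ e', ExtendInv n k a M b i e m T e' T' r' m')
    ⟨e, hr, hz, h8, h9, h10, le_rfl, heM, rfl, hmatch, .inl ⟨h11, le_rfl⟩⟩ ?_ ?_
  · rintro T₁ r₁ m₁ ⟨e', ⟨h0, h1, h2, h3⟩, ⟨h5, h6, h7⟩, h8, h9, h10, hee, he'M, rfl, hm, h11⟩ hlt
    obtain ⟨h11, hT₁⟩ : r₁ 11 = M ∧ T + 10 * e ≤ T₁ + 10 * e' := by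
      rcases h11 with h | h
      · exact h
      · omega
    rw [h10, h11] at hlt
    refine ⟨by omega, WP.seq (WP.block (by simp; omega) ?_)⟩
    simp [blockPre, h5, h8, h10]
    refine ⟨by omega, by omega, by omega, by omega, by omega,
      WP.ifEq (by omega) (fun heq => WP.block (by simp; omega) ?_)
        (fun hne => WP.block (by simp; omega) ?_)⟩
    · simp at heq
      simp [blockPre, h2, h10]
      refine ⟨by omega, e' + 1, ⟨by simpa, by simpa, by simpa, by simpa⟩,
        ⟨by simpa, by simpa, by simpa⟩, by simpa, by simpa, by simp, by omega, hlt, rfl, ?_,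
        .inl ⟨by simpa, by omega⟩⟩
      intro t ht
      by_cases h : t < e' - i
      · exact hm t h
      · obtain rfl : t = e' - i := by omega
        rw [show a + (e' - i) = e' - i + a by omega, ← heq]; congr 1; omega
    · simp at hne
      simp [blockPre, h10]
      refine ⟨e', ⟨by simpa, by simpa, by simpa, by simpa⟩,
        ⟨by simpa, by simpa, by simpa⟩, by simpa, by simpa, by simpa, hee, hlt.le, rfl, hm,
        .inr ⟨by simp, by omega, by omega, ?_⟩⟩
      rw [Nat.add_comm a, Nat.add_comm a]
      exact Ne.symm hne
  · rintro T₁ r₁ m₁ ⟨e', hr₁, hz₁, h8, h9, h10, hee, he'M, rfl, hm, h11⟩ hlt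
    refine ⟨by omega, hQ _ _ e' (by omega) hr₁ hz₁ h8 h9 h10 hee he'M
      (isPrefixLength_of_mismatch (by omega) hm fun h => ?_)⟩
    rcases h11 with h11 | h11
    · omega
    · rw [show i + (e' - i) = e' by omega]
      exact h11.2.2.2

/-- The Z-algorithm: for the string of length `r 6` at address `r 5`, writes the lengths of the
longest common prefixes of the string with its suffixes to the addresses from `r 7` on. -/
def zAlgorithm : Cmd :=
  .seq (.block [.store 7 6, .move 8 2, .move 9 2, .move 10 2])
    (.whileLt 8 6 (.seq (.block [.move 12 3]) (.seq
      (.ifLt 8 10 (.block [.sub 13 8 9, .add 13 13 7, .load 12 13]) (.block [.move 10 8])) (.seq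
      (.block [.sub 13 10 8]) (.seq
      (.ifLt 12 13 (.block [])
        (.seq (.block [.move 9 8, .move 11 6]) (.seq extendMatch (.block [.sub 12 10 8]))))
      (.block [.add 13 7 8, .store 13 12, .add 8 8 2]))))))

/-- The invariant of the outer loop of the Z-algorithm. -/
structure ZInv (n k a M b : ℕ) (m₀ : ℕ → ℕ) (T i l e T' : ℕ) (r m : ℕ → ℕ) : Prop where
  globals : Globals n k r
  args : ZArgs a M b r
  reg_i : r 8 = i
  reg_l : r 9 = l
  reg_e : r 10 = e
  one_le_l : 1 ≤ l
  l_le : l ≤ i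
  i_le : i ≤ M
  e_le : e ≤ M
  box : ∀ t, l ≤ t → t < e → m₀ (a + t) = m₀ (a + (t - l))
  frame : ∀ q, q < b ∨ b + i ≤ q → m q = m₀ q
  time : T ≤ T' + 45 * i + 10 * e
  table : ∀ q < i, IsPrefixLength (fun t => m₀ (a + t)) M q (m (b + q))

/-- The box `[l, e)` is a known occurrence of a prefix. The entry at `i` is copied from `i - l` if
it ends strictly inside the box; otherwise comparisons resume at the end of the box, and each
success moves `e` forward. As neither `i` nor `e` decreases or exceeds `M`, the potential `45 * i +
10 * e` bounds the total time. -/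
theorem wp_zAlgorithm {a M b : ℕ} (hS : S < 2 ^ w) (hr : Globals n k r) (hz : ZArgs a M b r)
    (hM : 1 ≤ M) (hab : a + M ≤ b) (hbS : b + M ≤ S) (hT : 60 * M + 60 ≤ T)
    (hQ : ∀ T' r' m', T ≤ T' + (60 * M + 60) → Globals n k r' →
      (∀ p, p < b ∨ b + M ≤ p → m' p = m p) →
      (∀ q < M, IsPrefixLength (fun t => m (a + t)) M q (m' (b + q))) → Q T' r' m') :
    WP w S zAlgorithm Q T r m := by
  obtain ⟨h0, h1, h2, h3⟩ := hr
  obtain ⟨h5, h6, h7⟩ := hz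
  refine WP.seq (WP.block (by simp; omega) ?_)
  simp [blockPre, h2, h6, h7]
  refine ⟨by omega, WP.whileLt (fun T' r' m' => ∃ i l e, ZInv n k a M b m T i l e T' r' m')
    ⟨1, 1, 1, ?_⟩ ?_ ?_⟩
  · refine ⟨⟨by simpa, by simpa, by simpa, by simpa⟩, ⟨by simpa, by simpa, by simpa⟩, by simp,
      by simp, by simp, le_rfl, le_rfl, hM, hM, by omega, fun q hq => ?_, by omega,
      fun q hq => ?_⟩
    · rw [Function.update_of_ne (by omega)]
    · obtain rfl : q = 0 := by omega
      simp only [Nat.add_zero, Function.update_self]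
      exact isPrefixLength_of_mismatch (by omega) (by simp) (by omega)
  · rintro T₁ r₁ m₁ ⟨i, l, e, hI⟩ hlt
    rw [hI.reg_i, hI.args.2.1] at hlt
    obtain ⟨hg, hz, h8, h9, h10, hl, hli, hiM, heM, hbox, hframe, hT₁, htable⟩ := hI
    obtain ⟨h0, h1, h2, h3⟩ := hg
    obtain ⟨h5, h6, h7⟩ := hz
    have hmem : ∀ t < M, m₁ (a + t) = m (a + t) := fun t ht => hframe _ (by omega)
    have finish : ∀ T₂ r₂ l' e' z, T ≤ T₂ + 45 * i + 42 + 10 * e' → 3 ≤ T₂ → Globals n k r₂ →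
        ZArgs a M b r₂ → r₂ 8 = i → r₂ 9 = l' → r₂ 10 = e' → r₂ 12 = z → 1 ≤ l' → l' ≤ i →
        e' ≤ M → (∀ t, l' ≤ t → t < e' → m (a + t) = m (a + (t - l'))) →
        IsPrefixLength (fun t => m (a + t)) M i z →
        WP w S (.block [.add 13 7 8, .store 13 12, .add 8 8 2])
          (fun T' r' m' => ∃ i l e, ZInv n k a M b m T i l e T' r' m') T₂ r₂ m₁ := by
      rintro T₂ r₂ l' e' z hT₂ hT₂' ⟨h0, h1, h2, h3⟩ ⟨h5, h6, h7⟩ h8 h9 h10 h12 hl hli heM hbox hz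
      refine WP.block (by simpa using hT₂') ?_
      simp [blockPre, h2, h7, h8, h12]
      refine ⟨by omega, by omega, by omega, i + 1, l', e', ⟨by simpa, by simpa, by simpa, by simpa⟩,
        ⟨by simpa, by simpa, by simpa⟩, by simp, by simpa, by simpa, hl, by omega, hlt, heM, hbox,
        fun q hq => ?_, by omega, fun q hq => ?_⟩
      · rw [Function.update_of_ne (by omega), hframe q (by omega)]
      · by_cases h : q = i
        · subst h; simpa using hz
        · rw [Function.update_of_ne (by omega)]
          exact htable q (by omega)
    -- Both cases of the first test continue here: `i` inside the box with `z` a copied entry, or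
    -- `i` beyond it with the empty box `e' = i` and `z = 0`.
    have tail : ∀ T₂ r₂ e' z, e ≤ e' → e' ≤ M → i ≤ e' → T ≤ T₂ + 45 * i + 12 + 10 * e →
        Globals n k r₂ → ZArgs a M b r₂ → r₂ 8 = i → r₂ 9 = l → r₂ 10 = e' → r₂ 12 = z →
        (z < e' - i → e' = e ∧ IsPrefixLength (fun t => m (a + t)) M i z) →
        (e' - i ≤ z → ∀ t < e' - i, m (a + t) = m (a + (i + t))) →
        WP w S (.seq (.block [.sub 13 10 8]) (.seq
          (.ifLt 12 13 (.block [])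
            (.seq (.block [.move 9 8, .move 11 6]) (.seq extendMatch (.block [.sub 12 10 8]))))
          (.block [.add 13 7 8, .store 13 12, .add 8 8 2])))
          (fun T' r' m' => ∃ i l e, ZInv n k a M b m T i l e T' r' m') T₂ r₂ m₁ := by
      rintro T₂ r₂ e' z hee he'M hie hT₂ ⟨h0, h1, h2, h3⟩ ⟨h5, h6, h7⟩ h8 h9 h10 h12 hz₁ hz₂
      refine WP.seq (WP.block (by simp; omega) ?_)
      simp [blockPre, h8, h10]
      refine ⟨by omega, WP.seq (WP.ifLt (by omega) (fun hlt => ?_) fun hlt => ?_)⟩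
      · simp [h12] at hlt
        obtain ⟨rfl, hz⟩ := hz₁ (by omega)
        refine WP.block (by simp) ?_
        simp only [blockPre]
        exact finish _ _ l e' z (by simp; omega) (by simp; omega) ⟨by simpa, by simpa, by simpa, by simpa⟩
          ⟨by simpa, by simpa, by simpa⟩ (by simpa) (by simpa) (by simpa) (by simpa) hl hli heM hbox
          hz
      · simp [h12] at hlt
        refine WP.seq (WP.block (by simp; omega) ?_)
        simp only [blockPre]
        refine WP.seq (wp_extendMatch (n := n) (k := k) (a := a) (M := M) (b := b) (i := i)
          (e := e') hS ⟨by simpa, by simpa, by simpa, by simpa⟩ ⟨by simpa, by simpa, by simpa⟩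
          (by simpa) (by simpa) (by simpa) (by simpa) hie he'M (by omega) (by simp; omega)
          (fun t ht => ?_) ?_)
        · rw [hmem _ (by omega), hmem _ (by omega)]
          exact hz₂ (by omega) t ht
        · rintro T₃ r₃ e'' hT₃ ⟨h0, h1, h2, h3⟩ ⟨h5, h6, h7⟩ h8 h9 h10 he₁ he₂ hz
          simp at hT₃
          have hz := hz.congr hmem
          refine WP.block (by simp; omega) ?_
          simp [blockPre, h8, h10]
          refine ⟨by omega, finish _ _ i e'' (e'' - i) (by omega) (by omega)
            ⟨by simpa, by simpa, by simpa, by simpa⟩ ⟨by simpa, by simpa, by simpa⟩ (by simpa)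
            (by simpa) (by simpa) (by simp) (by omega) le_rfl he₂ (fun t ht₁ ht₂ => ?_) hz⟩
          rw [hz.eq (t := t - i) (by omega), Nat.add_sub_cancel' ht₁]
    refine ⟨by omega, WP.seq (WP.block (by simp; omega) ?_)⟩
    simp only [blockPre]
    refine WP.seq (WP.ifLt (by simp; omega) (fun hie => ?_) fun hie => ?_)
    · simp [h8, h10] at hie
      refine WP.block (by simp; omega) ?_
      -- Because `1 ≤ l`, the entry at `i - l` has already been written.
      have htab := htable (i - l) (by omega)
      have hle := htab.add_le
      simp [blockPre, h7, h8, h9]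
      rw [Nat.add_comm b] at htab
      refine ⟨by omega, by omega, by omega, tail _ _ e _ le_rfl heM hie.le (by omega)
        ⟨by simpa, by simpa, by simpa, by simpa⟩ ⟨by simpa, by simpa, by simpa⟩ (by simpa)
        (by simpa) (by simpa) rfl (fun hlt => ⟨rfl, ?_⟩) fun hlt t ht => ?_⟩
      · simp at hlt ⊢
        exact htab.shift hli heM hbox (by omega)
      · simp at hlt
        rw [hbox (i + t) (by omega) (by omega), htab.eq (by omega)]
        congr 2; omega
    · simp [h8, h10] at hie
      refine WP.block (by simp; omega) ?_
      simp [blockPre, h8]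
      exact tail _ _ i _ hie hlt.le le_rfl (by omega)
        ⟨by simpa, by simpa, by simpa, by simpa⟩ ⟨by simpa, by simpa, by simpa⟩ (by simpa)
        (by simpa) (by simp) rfl (by omega) (by omega)
  · rintro T₁ r₁ m₁ ⟨i, l, e, hI⟩ hlt
    rw [hI.reg_i, hI.args.2.1] at hlt
    obtain rfl : i = M := le_antisymm hI.i_le (by omega)
    have := hI.e_le
    have := hI.time
    exact ⟨by omega, hQ _ _ _ (by omega) hI.globals hI.frame hI.table⟩

theorem wp_min {a d : ℕ} (hT : 3 ≤ T)
    (hQ : ∀ T', T ≤ T' + 3 → Q T' (Function.update r d (min (r d) (r a))) m) :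
    WP w S (.ifLt a d (.block [.move d a]) (.block [])) Q T r m := by
  refine WP.ifLt (by omega) (fun h => WP.block (by simp; omega) ?_)
    fun h => WP.block (by simp) ?_ <;> simp only [blockPre]
  · rw [← min_eq_right h.le]
    exact hQ _ (by simp; omega)
  · have := hQ (T - 2) (by omega)
    rwa [min_eq_left (not_lt.1 h), Function.update_eq_self] at this

theorem wp_max {a d : ℕ} (hT : 3 ≤ T)
    (hQ : ∀ T', T ≤ T' + 3 → Q T' (Function.update r d (max (r d) (r a))) m) :
    WP w S (.ifLt d a (.block [.move d a]) (.block [])) Q T r m := by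
  refine WP.ifLt (by omega) (fun h => WP.block (by simp; omega) ?_)
    fun h => WP.block (by simp) ?_ <;> simp only [blockPre]
  · rw [← max_eq_right h.le]
    exact hQ _ (by simp; omega)
  · have := hQ (T - 2) (by omega)
    rwa [max_eq_left (not_lt.1 h), Function.update_eq_self] at this

/-! ### Recording the intervals by their left ends. -/

/-- For every position `j` from the one in register `8` on, the table at address `r 5` and the one
that ends there, read backwards, give lengths `p` and `s` that are at most `k`. If `p + s` is at
least `k`, then the cell at address `r 6 + (j - s)` is raised to `j + p`. -/
def markIntervals : Cmd :=
  .whileLt 8 0 (.seq (.block [.add 9 5 8, .load 9 9]) (.seq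
    (.ifLt 1 9 (.block [.move 9 1]) (.block [])) (.seq
    (.block [.sub 10 5 8, .load 10 10]) (.seq
    (.ifLt 1 10 (.block [.move 10 1]) (.block [])) (.seq
    (.block [.add 11 9 10]) (.seq
    (.ifLt 11 1 (.block [])
      (.seq (.block [.sub 11 8 10, .add 11 11 6, .load 12 11, .add 13 8 9])
        (.ifLt 12 13 (.block [.store 11 13]) (.block []))))
    (.block [.add 8 8 2])))))))

/-- The value `v` lies below the right end of one of the intervals with left end `q` that belong to
positions below `j`. -/
def Marked (k : ℕ) (p s : ℕ → ℕ) (j q v : ℕ) : Prop :=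
  ∃ i < j, k ≤ p i + s i ∧ i - s i = q ∧ v < i + p i

theorem marked_succ {p s : ℕ → ℕ} {j q v : ℕ} :
    Marked k p s (j + 1) q v ↔
      Marked k p s j q v ∨ (k ≤ p j + s j ∧ j - s j = q ∧ v < j + p j) := by
  constructor
  · rintro ⟨i, hi, h⟩
    rcases Nat.lt_succ_iff_lt_or_eq.1 hi with hi | rfl
    · exact .inl ⟨i, hi, h⟩
    · exact .inr h
  · rintro (⟨i, hi, h⟩ | h)
    · exact ⟨i, by omega, h⟩
    · exact ⟨j, by omega, h⟩

/-- The invariant of `markIntervals` at position `j`. -/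
structure MarkInv (n k b : ℕ) (p s m₀ : ℕ → ℕ) (T j T' : ℕ) (r m : ℕ → ℕ) : Prop where
  globals : Globals n k r
  reg_b : r 5 = b
  reg_marks : r 6 = b + n
  reg_j : r 8 = j
  one_le : 1 ≤ j
  le : j ≤ n
  time : T ≤ T' + 40 * j
  frame : ∀ q < b + n, m q = m₀ q
  marks : ∀ q < n, ∀ v, v < m (b + n + q) ↔ Marked k p s j q v

/-- A cell is described by the numbers below it: it is the maximum of the recorded right ends, or 0
if there are none, and raising it amounts to the disjunction in `marked_succ`. The loop starts at `j
= 1` because for `j = 0` both tables would be read at the same address `b`. -/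
theorem wp_markIntervals {b : ℕ} {p s : ℕ → ℕ} (hS : S < 2 ^ w) (hr : Globals n k r)
    (h5 : r 5 = b) (h6 : r 6 = b + n) (h8 : r 8 = 1) (hn : 1 ≤ n) (hkn : k ≤ n) (hnb : n ≤ b)
    (hbS : b + 2 * n ≤ S) (hp : ∀ j, 1 ≤ j → j < n → p j = min (m (b + j)) k)
    (hs : ∀ j, 1 ≤ j → j < n → s j = min (m (b - j)) k ∧ s j ≤ j)
    (hmarks : ∀ q < n, ∀ v, v < m (b + n + q) ↔ Marked k p s 1 q v) (hT : 40 * n + 2 ≤ T)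
    (hQ : ∀ T' r' m', T ≤ T' + (40 * n + 2) → Globals n k r' → r' 6 = b + n →
      (∀ q < n, ∀ v, v < m' (b + n + q) ↔ Marked k p s n q v) → Q T' r' m') :
    WP w S markIntervals Q T r m := by
  refine WP.whileLt (fun T' r' m' => ∃ j, MarkInv n k b p s m T j T' r' m')
    ⟨1, hr, h5, h6, h8, le_rfl, hn, by omega, by simp, hmarks⟩ ?_ ?_
  · rintro T₁ r₁ m₁ ⟨j, ⟨h0, h1, h2, h3⟩, h5, h6, h8, hj, hjn, hT₁, hm, hmarks⟩ hlt
    rw [h8, h0] at hlt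
    have hpj := hp j hj hlt
    obtain ⟨hsj, hsj'⟩ := hs j hj hlt
    rw [← hm _ (by omega)] at hpj hsj
    have hpk : p j ≤ k := by omega
    refine ⟨by omega, WP.seq (WP.block (by simp; omega) ?_)⟩
    simp [blockPre, h5, h8]
    refine ⟨by omega, by omega, WP.seq (wp_min (by omega) fun T₂ hT₂ => ?_)⟩
    refine WP.seq (WP.block (by simp; omega) ?_)
    simp [blockPre, h1, h5, h8]
    refine ⟨by omega, by omega, WP.seq (wp_min (by omega) fun T₃ hT₃ => ?_)⟩
    refine WP.seq (WP.block (by simp; omega) ?_)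
    simp [blockPre, h1, ← hpj, ← hsj]
    have finish : ∀ T₄ r₄ m₄, T₁ ≤ T₄ + 35 → Globals n k r₄ → r₄ 5 = b → r₄ 6 = b + n → r₄ 8 = j →
        (∀ q < b + n, m₄ q = m₁ q) →
        (∀ q < n, ∀ v, v < m₄ (b + n + q) ↔ Marked k p s (j + 1) q v) →
        WP w S (.block [.add 8 8 2]) (fun T' r' m' => ∃ j, MarkInv n k b p s m T j T' r' m')
          T₄ r₄ m₄ := by
      rintro T₄ r₄ m₄ hT₄ ⟨h0, h1, h2, h3⟩ h5 h6 h8 hm₄ hmarks₄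
      refine WP.block (by simp; omega) ?_
      simp [blockPre, h2, h8]
      exact ⟨by omega, j + 1, ⟨by simpa, by simpa, by simpa, by simpa⟩, by simpa, by simpa, by simp,
        by omega, hlt, by omega, fun q hq => (hm₄ q hq).trans (hm q hq), hmarks₄⟩
    refine ⟨by omega, WP.seq (WP.ifLt (by omega) (fun h => ?_) fun h => ?_)⟩
    · simp [h1] at h
      refine WP.block (by simp) ?_
      simp only [blockPre]
      refine finish _ _ _ (by simp; omega) ⟨by simpa, by simpa, by simpa, by simpa⟩
        (by simpa) (by simpa) (by simpa) (fun _ _ => rfl) fun q hq v => ?_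
      rw [hmarks q hq, marked_succ]
      exact (or_iff_left (by omega)).symm
    · simp [h1] at h
      refine WP.seq (WP.block (by simp; omega) ?_)
      simp [blockPre, h6, h8]
      have hcell := hmarks (j - s j) (by omega)
      rw [Nat.add_comm (b + n)] at hcell
      refine ⟨by omega, by omega, by omega, by omega,
        WP.ifLt (by omega) (fun h' => WP.block (by simp; omega) ?_)
          fun h' => WP.block (by simp) ?_⟩
      · simp at h'
        simp [blockPre]
        refine ⟨by omega, finish _ _ _ (by omega) ⟨by simpa, by simpa, by simpa, by simpa⟩
          (by simpa) (by simpa) (by simpa) (fun q hq => ?_) fun q hq v => ?_⟩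
        · rw [Function.update_of_ne (by omega)]
        · rw [marked_succ]
          by_cases hq' : q = j - s j
          · subst hq'
            rw [Nat.add_comm (b + n), Function.update_self, ← hcell]
            omega
          · rw [Function.update_of_ne (by omega), hmarks q hq]
            exact (or_iff_left (by omega)).symm
      · simp at h'
        simp only [blockPre]
        refine finish _ _ _ (by simp; omega) ⟨by simpa, by simpa, by simpa, by simpa⟩
          (by simpa) (by simpa) (by simpa) (fun _ _ => rfl) fun q hq v => ?_
        rw [hmarks q hq, marked_succ]
        refine (or_iff_left_of_imp ?_).symm
        rintro ⟨-, rfl, hv⟩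
        exact (hcell v).1 (by omega)
  · rintro T₁ r₁ m₁ ⟨j, hg, h5, h6, h8, hj, hjn, hT₁, hm, hmarks⟩ hlt
    rw [h8, hg.1] at hlt
    obtain rfl : j = n := by omega
    exact ⟨by omega, hQ _ _ _ (by omega) hg h6 hmarks⟩

/-! ### The sweep that checks the covering. -/

/-- Tests whether the intervals recorded at address `r 6` cover all positions. -/
def checkCover : Cmd :=
  .seq (.block [.move 7 3, .move 8 3, .move 9 0, .move 10 2]) (.seq
    (.whileLt 7 9 (.seq (.block [.add 11 6 7, .load 11 11]) (.seq
      (.ifLt 8 11 (.block [.move 8 11]) (.block []))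
      (.ifLt 7 8 (.block [.add 7 7 2]) (.block [.move 10 3, .move 9 7])))))
    (.block [.move 0 10]))

/-- The invariant of the loop of `checkCover` at position `i`. The last alternative describes the
situation after a position that is not covered has been found. -/
structure CheckInv (n k b : ℕ) (μ : ℕ → ℕ) (T i T' : ℕ) (r m : ℕ → ℕ) : Prop where
  globals : Globals n k r
  reg_b : r 6 = b
  reg_i : r 7 = i
  le : i ≤ n
  mem : ∀ q < n, m (b + q) = μ q
  time : T ≤ T' + 20 * i + (if r 9 = n then 0 else 20)
  state : (r 9 = n ∧ r 10 = 1 ∧ (∀ v, v < r 8 ↔ ∃ q < i, v < μ q) ∧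
      ∀ q < i, ∃ q' ≤ q, q < μ q') ∨
    (r 9 = i ∧ r 10 = 0 ∧ i < n ∧ ¬ ∀ q < n, ∃ q' ≤ q, q < μ q')

/-- Position `i` is covered iff the greatest right end recorded at left ends up to `i` exceeds `i`;
right ends are exclusive. A running maximum suffices. -/
theorem wp_checkCover {b : ℕ} (hS : S < 2 ^ w) (hr : Globals n k r) (h6 : r 6 = b)
    (hbS : b + n ≤ S) (hT : 30 * n + 30 ≤ T)
    (hQ : ∀ T' r' m', ((r' 0 = 1 ∧ ∀ q < n, ∃ q' ≤ q, q < m (b + q')) ∨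
      (r' 0 = 0 ∧ ¬ ∀ q < n, ∃ q' ≤ q, q < m (b + q'))) → Q T' r' m') :
    WP w S checkCover Q T r m := by
  obtain ⟨h0, h1, h2, h3⟩ := hr
  refine WP.seq (WP.block (by simp; omega) ?_)
  simp [blockPre, h0, h2, h3]
  refine WP.seq (WP.whileLt
    (fun T' r' m' => ∃ i, CheckInv n k b (fun q => m (b + q)) (T - 4) i T' r' m')
    ⟨0, ⟨by simpa, by simpa, by simpa, by simpa⟩, by simpa, by simp, by omega, by simp, by simp,
      .inl ⟨by simp, by simp, by simp, by simp⟩⟩ ?_ ?_)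
  · rintro T₁ r₁ m₁ ⟨i, ⟨h0, h1, h2, h3⟩, h6, h7, hin, hm, hT₁, hst⟩ hlt
    obtain ⟨h9, h10, h8, hc⟩ : r₁ 9 = n ∧ r₁ 10 = 1 ∧
        (∀ v, v < r₁ 8 ↔ ∃ q < i, v < m (b + q)) ∧ ∀ q < i, ∃ q' ≤ q, q < m (b + q') := by
      rcases hst with h | h
      · exact h
      · omega
    rw [h7, h9] at hlt
    rw [if_pos h9] at hT₁
    refine ⟨by omega, WP.seq (WP.block (by simp; omega) ?_)⟩
    simp [blockPre, h6, h7]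
    refine ⟨by omega, by omega, WP.seq (wp_max (by omega) fun T₂ hT₂ => ?_)⟩
    simp [hm i hlt]
    have hmax : ∀ v, v < max (r₁ 8) (m (b + i)) ↔ ∃ q < i + 1, v < m (b + q) := fun v => by
      rw [lt_max_iff, h8]
      constructor
      · rintro (⟨q, hq, h⟩ | h)
        · exact ⟨q, by omega, h⟩
        · exact ⟨i, by omega, h⟩
      · rintro ⟨q, hq, h⟩
        rcases Nat.lt_succ_iff_lt_or_eq.1 hq with hq | rfl
        · exact .inl ⟨q, hq, h⟩
        · exact .inr h
    refine WP.ifLt (by omega) (fun h => WP.block (by simp; omega) ?_)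
      fun h => WP.block (by simp; omega) ?_
    · simp only [h7, Function.update_self, ne_eq, Nat.reduceEqDiff, not_false_eq_true,
        Function.update_of_ne] at h
      simp [blockPre, h2, h7]
      refine ⟨by omega, i + 1, ⟨by simpa, by simpa, by simpa, by simpa⟩, by simpa, by simp, hlt,
        hm, ?_, .inl ⟨by simpa, by simpa, by simpa using hmax, fun q hq => ?_⟩⟩
      · simp [h9]; omega
      · rcases Nat.lt_succ_iff_lt_or_eq.1 hq with hq | rfl
        · exact hc q hq
        · obtain ⟨q', hq', h'⟩ := (hmax _).1 h
          exact ⟨q', by omega, h'⟩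
    · simp only [h7, Function.update_self, ne_eq, Nat.reduceEqDiff, not_false_eq_true,
        Function.update_of_ne] at h
      simp [blockPre, h3, h7]
      refine ⟨i, ⟨by simpa, by simpa, by simpa, by simpa⟩, by simpa, by simpa, hin, hm, ?_,
        .inr ⟨by simp, by simp, hlt, fun hall => h ?_⟩⟩
      -- Lowering register `9` to `i < n` ends the loop and releases the extra 20 steps, which pay
      -- for this round, in which `i` does not advance.
      · simp [hlt.ne]; omega
      · obtain ⟨q', hq', h'⟩ := hall i hlt
        exact (hmax i).2 ⟨q', by omega, h'⟩
  · rintro T₁ r₁ m₁ ⟨i, hg, h6, h7, hin, hm, hT₁, hst⟩ hlt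
    have : 3 ≤ T₁ := by split_ifs at hT₁ <;> omega
    refine ⟨by omega, WP.block (by simp; omega) ?_⟩
    simp only [blockPre]
    refine hQ _ _ _ ?_
    rcases hst with ⟨h9, h10, -, hc⟩ | ⟨-, h10, -, hc⟩
    · obtain rfl : i = n := by omega
      exact .inl ⟨by simpa, hc⟩
    · exact .inr ⟨by simpa, hc⟩

/-- The criterion `cyclicCoverable_iff` in terms of the intervals that the program marks. -/
theorem cyclicCoverable_iff_marked {α : Type*} {x : List α} (hk : 1 ≤ k) (hkn : k ≤ x.length)
    {g : ℕ → ℕ} (hg : ∀ i < x.length, ∀ j < x.length, ∀ d, x.getD i d = x.getD j d ↔ g i = g j)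
    {pz sz : ℕ → ℕ}
    (hp : ∀ j < x.length, ∀ q, q ≤ min (pz j) k ↔
      q ≤ k ∧ j + q ≤ x.length ∧ ∀ t < q, g t = g (j + t))
    (hs : ∀ j, 1 ≤ j → j < x.length → ∀ q, q ≤ min (sz j) k ↔
      q ≤ k ∧ q ≤ j ∧ ∀ t < q, g (k - 1 - t) = g (j - 1 - t)) :
    CyclicCoverable k x ↔ ∀ q < x.length, ∃ q' ≤ q,
      Marked k (fun j => min (pz j) k) (fun j => if j = 0 then 0 else min (sz j) k)
        x.length q' q := by
  rw [cyclicCoverable_iff hk hkn hg hp (s := fun j => if j = 0 then 0 else min (sz j) k)]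
  · refine forall₂_congr fun q hq => ⟨?_, ?_⟩
    · rintro ⟨j, hj, h, hq, hq'⟩
      exact ⟨_, hq, j, hj, h, rfl, hq'⟩
    · rintro ⟨_, hq, j, hj, h, rfl, hq'⟩
      exact ⟨j, hj, h, hq, hq'⟩
  · intro j hj q
    -- No letters precede position 0, so its suffix length is 0, whatever `sz 0` is.
    by_cases h : j = 0
    · subst h
      simp only [if_true]
      refine ⟨fun h => ⟨by omega, h, by omega⟩, fun h => h.2.1⟩
    · simpa only [if_neg h] using hs j (by omega) hj q

/-! ### The two tables, and the whole program. -/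

/-- Computes the lengths of common prefixes and suffixes. The string `u` of the first `k` letters
is reversed and put in front of the reversed string; the Z-algorithm runs on the result and on the
string itself. -/
def computeTables : Cmd :=
  .seq (.block [.const 2 1, .move 5 1, .move 6 0]) (.seq reverseCopy (.seq
  (.block [.move 5 0]) (.seq reverseCopy (.seq
  (.block [.move 7 6, .move 5 0, .sub 6 6 0]) (.seq zAlgorithm (.seq
  (.block [.move 5 3, .move 6 0, .add 7 0 0, .add 7 7 0, .add 7 7 1, .add 7 7 1])
  zAlgorithm))))))

-- Memory layout: the string at `0`, the reversed prefix at `n`, the reversed string at `n + k`, the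
-- table of these two at `2 * n + k`, the table of the string at `3 * n + 2 * k`. The suffix length
-- at `j` has index `n + k - j` in the former table, which is `j` cells below the start of the
-- latter. No separator is needed, since lengths capped at `k` only involve the first `k` letters.
set_option maxHeartbeats 1000000 in
theorem wp_computeTables (hk : 1 ≤ k) (hkn : k ≤ n) (hS : S < 2 ^ w) (hnS : 7 * n ≤ S)
    (h0 : r 0 = n) (h1 : r 1 = k) (h3 : r 3 = 0) (hT : 400 * n ≤ T)
    (hQ : ∀ T' r' m', T ≤ T' + 400 * n → Globals n k r' →
      (∀ q, 4 * n + 2 * k ≤ q → m' q = m q) →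
      (∀ j < n, ∀ q, q ≤ min (m' (3 * n + 2 * k + j)) k ↔
        q ≤ k ∧ j + q ≤ n ∧ ∀ t < q, m t = m (j + t)) →
      (∀ j, 1 ≤ j → j < n → ∀ q, q ≤ min (m' (3 * n + 2 * k - j)) k ↔
        q ≤ k ∧ q ≤ j ∧ ∀ t < q, m (k - 1 - t) = m (j - 1 - t)) → Q T' r' m') :
    WP w S computeTables Q T r m := by
  -- The constant 1 has to fit into a word.
  have hw : w ≠ 0 := by
    rintro rfl
    simp at hS; omega
  refine WP.seq (WP.block (by simp; omega) ?_)
  simp [blockPre]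
  refine ⟨hw, WP.seq (wp_reverseCopy (n := n) (k := k) (L := k) (D := n) hS
    ⟨by simpa, by simpa, by simp, by simpa⟩ (by simpa) (by simpa) (by omega) (by omega)
    (by omega) ?_)⟩
  rintro T₁ r₁ m₁ hT₁ ⟨h0, h1, h2, h3⟩ h6 hf₁ hc₁
  refine WP.seq (WP.block (by simp; omega) ?_)
  simp [blockPre]
  refine WP.seq (wp_reverseCopy (n := n) (k := k) (L := n) (D := n + k) hS
    ⟨by simpa, by simpa, by simpa, by simpa⟩ (by simpa)
    (by simpa) (by omega) (by omega) (by omega) ?_)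
  rintro T₂ r₂ m₂ hT₂ ⟨h0, h1, h2, h3⟩ h6 hf₂ hc₂
  refine WP.seq (WP.block (by simp; omega) ?_)
  simp [blockPre, h0, h6]
  refine ⟨by omega, WP.seq (wp_zAlgorithm (n := n) (k := k) (a := n) (M := n + k)
    (b := 2 * n + k) hS ⟨by simpa, by simpa, by simpa, by simpa⟩ ⟨by simp, by simp,
    by simp; omega⟩ (by omega) (by omega) (by omega) (by omega) ?_)⟩
  rintro T₃ r₃ m₃ hT₃ ⟨h0, h1, h2, h3⟩ hf₃ hz₃
  refine WP.seq (WP.block (by simp; omega) ?_)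
  simp [blockPre, h0, h1, h3]
  refine ⟨by omega, by omega, by omega, by omega, wp_zAlgorithm (n := n) (k := k) (a := 0)
    (M := n) (b := 3 * n + 2 * k) hS ⟨by simpa, by simpa, by simpa, by simpa⟩
    ⟨by simp, by simp, by simp; omega⟩ (by omega) (by omega) (by omega) (by omega) ?_⟩
  rintro T₄ r₄ m₄ hT₄ hr₄ hf₄ hz₄
  refine hQ _ _ _ (by omega) hr₄ (fun q hq => ?_) (fun j hj q => ?_) fun j hj hjn q => ?_
  · rw [hf₄ q (by omega), hf₃ q (by omega), hf₂ q (by omega), hf₁ q (by omega)]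
  · have hx₃ : ∀ q < n, m₃ q = m q := fun q hq => by
      rw [hf₃ q (by omega), hf₂ q (by omega), hf₁ q (by omega)]
    rw [le_min_iff, and_comm, hz₄ j hj q]
    refine and_congr_right fun hq => and_congr_right fun hq' => forall₂_congr fun t ht => ?_
    simp only [Nat.zero_add]
    rw [hx₃ _ (by omega), hx₃ _ (by omega)]
  · have hpat : ∀ q < k, m₂ (n + q) = m (k - 1 - q) := fun q hq => by
      rw [hf₂ _ (by omega), hc₁ q hq]
    have htext : ∀ q < n, m₂ (n + (k + q)) = m (n - 1 - q) := fun q hq => by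
      rw [← Nat.add_assoc, hc₂ q hq, hf₁ _ (by omega)]
    rw [le_min_iff, and_comm, hf₄ _ (by omega),
      show 3 * n + 2 * k - j = 2 * n + k + (n + k - j) by omega, hz₃ _ (by omega) q]
    refine and_congr_right fun hq => ?_
    rw [show n + k - j + q ≤ n + k ↔ q ≤ j by omega]
    refine and_congr_right fun hqj => forall₂_congr fun t ht => ?_
    change m₂ (n + t) = m₂ (n + (n + k - j + t)) ↔ _
    rw [hpat t (by omega), show n + (n + k - j + t) = n + (k + (n - j + t)) by omega,
      htext _ (by omega), show n - 1 - (n - j + t) = j - 1 - t by omega]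

/-- The whole program. -/
def cyclicCover : Cmd :=
  .seq computeTables (.seq
  (.block [.add 5 0 0, .add 5 5 0, .add 5 5 1, .add 5 5 1, .add 6 5 0, .store 6 1, .move 8 2])
  (.seq markIntervals checkCover))

theorem wp_cyclicCover {σ : ℕ} {x : List (Fin σ)} (hx : x.length = n) (hk : 1 ≤ k) (hkn : k ≤ n)
    (hS : S < 2 ^ w) (hnS : 7 * n ≤ S) (hT : 600 * n ≤ T)
    (hQ : ∀ T' r' m', ((r' 0 = 1 ∧ CyclicCoverable k x) ∨ (r' 0 = 0 ∧ ¬ CyclicCoverable k x)) →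
      Q T' r' m') :
    WP w S cyclicCover Q T (initial x k).reg (initial x k).mem := by
  refine WP.seq (wp_computeTables hk hkn hS hnS (by simp [initial, hx]) (by simp [initial])
    (by simp [initial]) (by omega) ?_)
  rintro T₁ r₁ m₁ hT₁ ⟨h0, h1, h2, h3⟩ hf hp hs
  -- The cells beyond the tables still hold their initial 0, which means that no interval is
  -- recorded.
  have hf₀ : ∀ q, 4 * n + 2 * k ≤ q → m₁ q = 0 := fun q hq => by
    rw [hf q hq]
    simp [initial, show x.length ≤ q by omega]
  have hgx : ∀ i < x.length, ∀ j < x.length, ∀ d,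
      x.getD i d = x.getD j d ↔ (initial x k).mem i = (initial x k).mem j := by
    intro i hi j hj d
    simp [initial, hi, hj, Fin.val_inj]
  have hcover := cyclicCoverable_iff_marked hk (by omega) hgx
    (pz := fun j => m₁ (3 * n + 2 * k + j)) (sz := fun j => m₁ (3 * n + 2 * k - j))
    (by rwa [hx]) (by rwa [hx])
  -- Position 0 contributes the interval `[0, k)`; the program records it by writing `k` into the
  -- first mark before the loop.
  have hp0 : min (m₁ (3 * n + 2 * k)) k = k :=
    le_antisymm (min_le_right _ _)
      ((hp 0 (by omega) k).2 ⟨le_rfl, by omega, fun t _ => by rw [Nat.zero_add]⟩)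
  have hsj : ∀ j, 1 ≤ j → j < n → min (m₁ (3 * n + 2 * k - j)) k ≤ j := fun j hj hjn =>
    ((hs j hj hjn _).1 le_rfl).2.1
  clear hp hs hf hgx
  rw [hx] at hcover
  refine WP.seq (WP.block (by simp; omega) ?_)
  simp [blockPre, h0, h1, h2]
  refine ⟨by omega, by omega, by omega, by omega, by omega, by omega, ?_⟩
  have hb : n + n + n + k + k = 3 * n + 2 * k := by omega
  rw [hb]
  refine WP.seq (wp_markIntervals (n := n) (k := k) (b := 3 * n + 2 * k)
    (p := fun j => min (m₁ (3 * n + 2 * k + j)) k)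
    (s := fun j => if j = 0 then 0 else min (m₁ (3 * n + 2 * k - j)) k)
    hS ⟨by simpa, by simpa, by simpa, by simpa⟩ (by simp) (by simp) (by simp) (by omega) hkn
    (by omega) (by omega) (fun j hj hjn => ?_) (fun j hj hjn => ?_) (fun q hq v => ?_)
    (by omega) ?_)
  · rw [Function.update_of_ne (by omega)]
  · rw [Function.update_of_ne (by omega), if_neg (by omega)]
    exact ⟨rfl, hsj j hj hjn⟩
  · rw [marked_succ]
    by_cases hq0 : q = 0
    · subst hq0
      simp [Marked, hp0]
    · rw [Function.update_of_ne (by omega), hf₀ _ (by omega)]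
      simp [Marked, Ne.symm hq0]
  · rintro T₂ r₂ m₂ hT₂ hr₂ h6 hmarks
    refine wp_checkCover hS hr₂ h6 (by omega) (by omega) fun T' r' m' h => hQ _ _ _ ?_
    have : CyclicCoverable k x ↔ ∀ q < n, ∃ q' ≤ q, q < m₂ (3 * n + 2 * k + n + q') := by
      rw [hcover]
      refine forall₂_congr fun q hq => exists_congr fun q' => and_congr_right fun hq' => ?_
      exact (hmarks q' (by omega) q).symm
    rwa [this]

end WordRAM

theorem theorem4 :
    ∃ (P : WordRAM.Program) (C : ℕ),
      ∀ (w σ n k : ℕ) (x : List (Fin σ)),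
        x.length = n → 1 ≤ k → k ≤ n → σ ≤ 2 ^ w → C * n < 2 ^ w →
          (CyclicCoverable k x →
            WordRAM.HaltsWithin P w (WordRAM.initial x k) (C * n) (C * n) 1) ∧
          (¬ CyclicCoverable k x →
            WordRAM.HaltsWithin P w (WordRAM.initial x k) (C * n) (C * n) 0) := by
  -- The factor 600 comes from the time bound; `7 * n` cells would be enough. With `600 * n < 2 ^
  -- w`, no address or computed number overflows.
  refine ⟨WordRAM.cyclicCover.compile 0, 600, fun w σ n k x hx hk hkn _ hw => ⟨fun h => ?_,
    fun h => ?_⟩⟩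
  all_goals
    refine WordRAM.WP.haltsWithin
      (WordRAM.wp_cyclicCover hx hk hkn hw (by omega) le_rfl fun T' r' m' h' => ?_)
    simpa [h] using h'
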